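/- Throughout, Banach spaces are real, $E^*$ is the continuous dual of $E$, and $E$ is identified with its canonical image in $E^{**}$. A set-valued operator $A:E\rightrightarrows E^*$ is identified with its graph $\operatorname{gra}A\subseteq E\times E^*$. It is *monotone* if $\langle x-y,x^*-y^*\rangle\ge 0$ for all $(x,x^*),(y,y^*)\in\operatorname{gra}A$, *maximally monotone* if moreover its graph has no proper monotone extension in $E\times E^*$ (likewise for graphs in $E^{**}\times E^*$), a *linear operator* if it is single-valued on its domain and its graph is a linear subspace, and *skew* if $\operatorname{gra}A\subseteq\operatorname{gra}(-A^*)$, where $\operatorname{gra}A^*=\{(x^{**},x^*)\in E^{**}\times E^*: \langle a,x^*\rangle=\langle a^*,x^{**}\rangle\ \forall (a,a^*)\in\operatorname{gra}A\}$. A maximally monotone $A:E\rightrightarrows E^*$ is * *of type (D)* if for every $(x^{**},x^*)\in E^{**}\times E^*$ with $\inf_{(a,a^*)\in\operatorname{gra}A}\langle a-x^{**},a^*-x^*\rangle\ge 0$ there is a bounded net in $\operatorname{gra}A$ converging to $(x^{**},x^*)$ in the weak$^*\times$norm topology; * *of type (BR)* if for all $(x,x^*)\in E\times E^*$ and $\alpha,\beta>0$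 with $\inf_{(a,a^*)\in\operatorname{gra}A}\langle x-a,x^*-a^*\rangle>-\alpha\beta$ there is $(b,b^*)\in\operatorname{gra}A$ with $\|x-b\|<\alpha$ and $\|x^*-b^*\|<\beta$; * *unique* if all maximally monotone extensions of $\operatorname{gra} A$ in $E^{**}\times E^*$ coincide. The space $E$ is *of type (D)* if every maximally monotone operator on $E$ is of type (D). A *Schauder basis* of a Banach space $X$ is a sequence $(e_n,e_n^*)_{n\ge1}$ in $X\times X^*$ with $\langle e_i,e_j^*\rangle=\delta_{ij}$ and $x=\sum_{n\ge1}\langle x,e_n^*\rangle e_n$ for all $x\in X$ (norm convergence of partial sums). It is *shrinking* if $\overline{\operatorname{span}}\{e_n^*\}=X^*$. The *James space* $\mathbf J$ is the space of all $x=(x_n)\in c_0$ with finite norm $$\|x\|=\sup_{n_1<\cdots<n_k}\big((x_{n_1}-x_{n_2})^2+\cdots+(x_{n_{k-1}}-x_{n_k})^2\big)^{1/2}.$$ **(i)** Let $(e_n,e_n^*)$ be a shrinking Schauder basis of a Banach space $X$ and suppose that $\sum_{i=1}^n e_i$ converges weak$^*$ to some $e\in X^{**}$. Define $A:X^*\rightrightarrows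 X^{**}$ by $$\operatorname{gra}A=\Big\{(y^*,y^{**})\in X^*\times X^{**}:\ \sum_{n=1}^k\Big(\sum_{i>n}\langle e_i,y^*\rangle-\sum_{i<n}\langle e_i,y^*\rangle\Big)e_n\ \overset{w^*}{\longrightarrow}\ y^{**}\ (k\to\infty)\Big\},$$ where $\sum_{i>n}\langle e_i,y^*\rangle$ is the limit of its partial sums. Then $A$ is a maximally monotone, skew linear operator, and it is of type (BR). **(ii)** The unit vectors $e_n=(0,\dots,0,1,0,\dots)$, together with their coordinate functionals $e_n^*$, form a shrinking Schauder basis of $\mathbf J$, and $\sum_{i=1}^n e_i$ converges weak$^*$ to an element $e\in\mathbf J^{**}$ with $\langle e,e_n^*\rangle=1$ for all $n$ (the constant sequence $1$). With $A:\mathbf J^*\rightrightarrows\mathbf J^{**}$ defined as in (i) from these data, the operator $A+\langle\cdot,e\rangle e$ is maximally monotone, is not of type (D), and is not unique. **(iii)** If $Z$ is a Banach space and there is a continuous linear injection $L:\mathbf J^*\to Z$ whose inverse is continuous on $\operatorname{ran}L$, then $Z$ is not of type (D). -/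

import Mathlib

open Filter Topology NormedSpace

noncomputable section

namespace MonotoneOp

universe u v

/-! ### Monotone graphs

A set-valued operator is given by its graph, a set of pairs. For the duality pairing between
`E` and its dual the second component is applied to the first; graphs inside
`E** × E*` are used for extensions to the bidual. -/

/-- The canonical image of `x` in the bidual. -/
abbrev incl {E : Type u} [NormedAddCommGroup E] [NormedSpace ℝ E] (x : E) :
    StrongDual ℝ (StrongDual ℝ E) :=
  inclusionInDoubleDual ℝ E x

/-- Monotonicity of a graph in `E × F` with respect to a bilinear pairing of `E` and `F`. -/
def IsMonotone {E : Type u} {F : Type v} [AddCommGroup E] [Module ℝ E] [AddCommGroup F]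
    [Module ℝ F] (B : E →ₗ[ℝ] F →ₗ[ℝ] ℝ) (A : Set (E × F)) : Prop :=
  ∀ p ∈ A, ∀ q ∈ A, 0 ≤ B (p.1 - q.1) (p.2 - q.2)

/-- `A` is monotone and has no proper monotone extension. -/
def IsMaxMonotone {E : Type u} {F : Type v} [AddCommGroup E] [Module ℝ E] [AddCommGroup F]
    [Module ℝ F] (B : E →ₗ[ℝ] F →ₗ[ℝ] ℝ) (A : Set (E × F)) : Prop :=
  Maximal (IsMonotone B) A

section Banach

variable {E : Type u} [NormedAddCommGroup E] [NormedSpace ℝ E]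

/-- `A : E ⇉ E*` is maximally monotone, for the pairing `⟨x, x*⟩ = x* x`. -/
def MaxMonotone (A : Set (E × StrongDual ℝ E)) : Prop :=
  IsMaxMonotone (topDualPairing ℝ E).flip A

/-- A graph in `E** × E*` is maximally monotone, for the pairing `⟨x**, x*⟩ = x** x*`. -/
def MaxMonotoneBidual (G : Set (StrongDual ℝ (StrongDual ℝ E) × StrongDual ℝ E)) : Prop :=
  IsMaxMonotone (topDualPairing ℝ (StrongDual ℝ E)) G

/-- `A` is a linear (possibly not everywhere defined, single-valued) operator. -/
def IsLinearOperator (A : Set (E × StrongDual ℝ E)) : Prop :=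
  ∃ L : E →ₗ.[ℝ] StrongDual ℝ E, (L.graph : Set (E × StrongDual ℝ E)) = A

/-- The graph in `E** × E*` of the adjoint: the pairs `(x**, x*)` such that `(x*, -x**)`
annihilates `A`. -/
def adjointGraph (A : Set (E × StrongDual ℝ E)) :
    Set (StrongDual ℝ (StrongDual ℝ E) × StrongDual ℝ E) :=
  {q | ∀ p ∈ A, q.2 p.1 + (-q.1) p.2 = 0}

/-- `A` is skew: the graph of `A` is contained in the graph of `-A*`. -/
def IsSkew (A : Set (E × StrongDual ℝ E)) : Prop :=
  ∀ p ∈ A, (incl p.1, -p.2) ∈ adjointGraph A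

/-- Weak* convergence of a net or sequence in the dual of `E`. -/
def WeakStarTendsto {ι : Type*} (f : ι → StrongDual ℝ E) (l : Filter ι) (x : StrongDual ℝ E) :
    Prop :=
  Tendsto (fun i => StrongDual.toWeakDual (f i)) l (𝓝 (StrongDual.toWeakDual x))

/-- `A` is of dense type, or type (D): every `(x**, x*)` with
`inf_{(a, a*) ∈ A} ⟨a - x**, a* - x*⟩ ≥ 0` is the weak* × strong limit of a bounded net in `A`. -/
def IsTypeD (A : Set (E × StrongDual ℝ E)) : Prop :=
  ∀ (x'' : StrongDual ℝ (StrongDual ℝ E)) (x' : StrongDual ℝ E),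
    (∀ p ∈ A, 0 ≤ (incl p.1 - x'') (p.2 - x')) →
    ∃ (Γ : Type u) (_ : Preorder Γ) (_ : IsDirectedOrder Γ) (_ : Nonempty Γ)
      (a : Γ → E × StrongDual ℝ E),
      (∀ γ, a γ ∈ A) ∧ Bornology.IsBounded (Set.range a) ∧
      WeakStarTendsto (fun γ => incl (a γ).1) atTop x'' ∧
      Tendsto (fun γ => (a γ).2) atTop (𝓝 x')

/-- `A` is of Brøndsted–Rockafellar type (BR). The hypothesis
`inf_{(a, a*) ∈ A} ⟨x - a, x* - a*⟩ > -αβ` is expressed by a lower bound `c > -αβ`. -/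
def IsTypeBR (A : Set (E × StrongDual ℝ E)) : Prop :=
  ∀ (x : E) (x' : StrongDual ℝ E) (α β : ℝ), 0 < α → 0 < β →
    (∃ c : ℝ, -(α * β) < c ∧ ∀ p ∈ A, c ≤ (x' - p.2) (x - p.1)) →
    ∃ b ∈ A, ‖x - b.1‖ < α ∧ ‖x' - b.2‖ < β

/-- `A` is unique: all maximally monotone extensions of `A` in `E** × E*` coincide. -/
def IsUnique (A : Set (E × StrongDual ℝ E)) : Prop :=
  ∀ G₁ G₂ : Set (StrongDual ℝ (StrongDual ℝ E) × StrongDual ℝ E),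
    MaxMonotoneBidual G₁ → MaxMonotoneBidual G₂ →
    (∀ p ∈ A, (incl p.1, p.2) ∈ G₁) → (∀ p ∈ A, (incl p.1, p.2) ∈ G₂) → G₁ = G₂

variable (E) in
/-- `E` is a space of type (D): every maximally monotone operator on `E` is of type (D). -/
def IsTypeDSpace : Prop :=
  ∀ A : Set (E × StrongDual ℝ E), MaxMonotone A → IsTypeD A

/-- The graph of `A + ⟨·, e⟩ e`. -/
def addRankOne (A : Set (E × StrongDual ℝ E)) (e : StrongDual ℝ E) :
    Set (E × StrongDual ℝ E) :=
  {p | ∃ z : StrongDual ℝ E, (p.1, z) ∈ A ∧ p.2 = z + (e p.1) • e}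

end Banach

section Basis

variable {X : Type u} [NormedAddCommGroup X] [NormedSpace ℝ X]

/-- A Schauder basis is shrinking if the closed span of its coordinate functionals is the
whole dual. -/
def IsShrinking (b : SchauderBasis ℝ X) : Prop :=
  (Submodule.span ℝ (Set.range b.coord)).topologicalClosure = ⊤

/-- The graph in `X* × X**` of all pairs `(y*, y**)` such that
`∑_{n ≤ k} (∑_{i > n} ⟨e i, y*⟩ - ∑_{i < n} ⟨e i, y*⟩) e n` converges weak* to `y**` as `k → ∞`.
Here `t n` is the sum of the (possibly only conditionally) convergent series
`∑_{i > n} ⟨e i, y*⟩`. -/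
def basisOperator (e : ℕ → X) : Set (StrongDual ℝ X × StrongDual ℝ (StrongDual ℝ X)) :=
  {p | ∃ t : ℕ → ℝ,
    (∀ n, Tendsto (fun N => ∑ i ∈ Finset.Ioc n N, p.1 (e i)) atTop (𝓝 (t n))) ∧
    WeakStarTendsto
      (fun k => incl (∑ n ∈ Finset.range k, (t n - ∑ i ∈ Finset.range n, p.1 (e i)) • e n))
      atTop p.2}

end Basis

/-! ### The James space -/

/-- A finite increasing sequence `n_0 < ⋯ < n_k` of indices, given by its length `k` and a
strictly increasing sequence of which it is an initial segment. -/
abbrev Chain : Type := ℕ × {s : ℕ → ℕ // StrictMono s}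

/-- `((x_{n_0} - x_{n_1})² + ⋯ + (x_{n_{k-1}} - x_{n_k})²)^{1/2}`. -/
def chainNorm (c : Chain) (x : ℕ → ℝ) : ℝ :=
  √(∑ i ∈ Finset.range c.1, (x (c.2.1 i) - x (c.2.1 (i + 1))) ^ 2)

lemma chainNorm_nonneg (c : Chain) (x : ℕ → ℝ) : 0 ≤ chainNorm c x := Real.sqrt_nonneg _

lemma chainNorm_eq (c : Chain) (x : ℕ → ℝ) : chainNorm c x =
    ‖(WithLp.toLp 2 (fun i : Fin c.1 => x (c.2.1 i) - x (c.2.1 (i + 1))) :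
      EuclideanSpace ℝ (Fin c.1))‖ := by
  rw [chainNorm, EuclideanSpace.norm_eq, Finset.sum_range]
  simp

lemma chainNorm_add (c : Chain) (x y : ℕ → ℝ) :
    chainNorm c (x + y) ≤ chainNorm c x + chainNorm c y := by
  simp only [chainNorm_eq]
  refine le_trans (le_of_eq ?_) (norm_add_le _ _)
  congr 1
  ext i
  simp only [Pi.add_apply, PiLp.add_apply]
  ring

lemma chainNorm_smul (c : Chain) (r : ℝ) (x : ℕ → ℝ) :
    chainNorm c (r • x) = |r| * chainNorm c x := by
  simp only [chainNorm_eq]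
  rw [← Real.norm_eq_abs, ← norm_smul]
  congr 1
  ext i
  simp only [Pi.smul_apply, PiLp.smul_apply, smul_eq_mul]
  ring

/-- The null sequences with finite James norm. -/
def jamesSubmodule : Submodule ℝ (ℕ → ℝ) where
  carrier := {x | Tendsto x atTop (𝓝 0) ∧ BddAbove (Set.range fun c : Chain => chainNorm c x)}
  zero_mem' := by
    refine ⟨tendsto_const_nhds, 0, ?_⟩
    rintro _ ⟨c, rfl⟩
    simp [chainNorm]
  add_mem' := by
    rintro x y ⟨hx, M, hM⟩ ⟨hy, N, hN⟩
    refine ⟨by simpa using! hx.add hy, M + N, ?_⟩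
    rintro _ ⟨c, rfl⟩
    exact (chainNorm_add c x y).trans (add_le_add (hM ⟨c, rfl⟩) (hN ⟨c, rfl⟩))
  smul_mem' := by
    rintro r x ⟨hx, M, hM⟩
    refine ⟨by simpa using! hx.const_smul r, |r| * M, ?_⟩
    rintro _ ⟨c, rfl⟩
    simp only [chainNorm_smul]
    exact mul_le_mul_of_nonneg_left (hM ⟨c, rfl⟩) (abs_nonneg r)

/-- The James space `J`. -/
def James : Type := jamesSubmodule

namespace James

instance : AddCommGroup James := inferInstanceAs (AddCommGroup jamesSubmodule)

instance : Module ℝ James := inferInstanceAs (Module ℝ jamesSubmodule)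

/-- The sequence underlying an element of `J`. -/
def toSeq (x : James) : ℕ → ℝ := Subtype.val (p := (· ∈ jamesSubmodule)) x

instance : Norm James := ⟨fun x => ⨆ c : Chain, chainNorm c x.toSeq⟩

lemma norm_def (x : James) : ‖x‖ = ⨆ c : Chain, chainNorm c x.toSeq := rfl

lemma toSeq_add (x y : James) : (x + y).toSeq = x.toSeq + y.toSeq := rfl

lemma toSeq_smul (r : ℝ) (x : James) : (r • x).toSeq = r • x.toSeq := rfl

lemma tendsto_toSeq (x : James) : Tendsto x.toSeq atTop (𝓝 0) :=
  (Subtype.property (p := (· ∈ jamesSubmodule)) x).1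

lemma bddAbove (x : James) : BddAbove (Set.range fun c : Chain => chainNorm c x.toSeq) :=
  (Subtype.property (p := (· ∈ jamesSubmodule)) x).2

instance : Nonempty Chain := ⟨(0, ⟨id, strictMono_id⟩)⟩

lemma abs_sub_le (x : James) {m n : ℕ} (h : m < n) : |x.toSeq m - x.toSeq n| ≤ ‖x‖ := by
  let s : ℕ → ℕ := fun i => if i = 0 then m else n + (i - 1)
  have hs : StrictMono s := by
    refine strictMono_nat_of_lt_succ fun i => ?_
    rcases i with _ | i
    · simpa [s] using h
    · simp [s]
  have := le_ciSup x.bddAbove (1, ⟨s, hs⟩)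
  rw [norm_def]
  simpa [chainNorm, s, Real.sqrt_sq_eq_abs] using this

lemma core : NormedSpace.Core ℝ James where
  norm_nonneg x := Real.iSup_nonneg fun c => chainNorm_nonneg c _
  norm_smul r x := by
    simp only [norm_def, toSeq_smul, chainNorm_smul, Real.norm_eq_abs]
    exact (Real.mul_iSup_of_nonneg (abs_nonneg r) _).symm
  norm_triangle x y := by
    refine ciSup_le fun c => ?_
    rw [toSeq_add]
    exact (chainNorm_add c _ _).trans (add_le_add (le_ciSup x.bddAbove c) (le_ciSup y.bddAbove c))
  norm_eq_zero_iff x := by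
    constructor
    · intro h
      have key : ∀ m, x.toSeq m = 0 := fun m => by
        have h1 : Tendsto x.toSeq atTop (𝓝 (x.toSeq m)) := by
          refine tendsto_const_nhds.congr' ?_
          filter_upwards [eventually_gt_atTop m] with n hn
          have := x.abs_sub_le hn
          rw [h] at this
          exact sub_eq_zero.1 (abs_nonpos_iff.1 this)
        exact tendsto_nhds_unique h1 x.tendsto_toSeq
      exact Subtype.ext (funext key)
    · rintro rfl
      have h0 : (0 : James).toSeq = 0 := rfl
      simp [norm_def, h0, chainNorm]

instance : NormedAddCommGroup James := NormedAddCommGroup.ofCore core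

instance : NormedSpace ℝ James := NormedSpace.ofCore core

end James

end MonotoneOp

end

open MonotoneOp

/-! Write `s_n` for the sum of the first `n` values `y* (b i)`, so that `s_n → e y*`. The operator
`A` sends `y*` to the element whose `n`-th coordinate is `e y* - s_n - s_{n+1}`. Multiplying by
`s_{n+1} - s_n` telescopes, so `⟨y*, A y*⟩ = lim (e y* · s_k - s_k²) = 0` and `A` is skew. The
domain contains every coordinate functional, and testing a pair against real multiples of these
gives an affine function of the scalar. A lower bound of any size makes its slope vanish, which is
the coordinate formula. Hence `mem_basisOperator_of_le`, which yields both maximality and type (BR).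

Let `B = A + ⟨·, e⟩ e`, so that `⟨y*, B y*⟩ = (e y*)²`. If the coordinate functionals are bounded,
they have a weak* cluster point `f` in `X***`, with `f e = 1` and `f (A y*) = -e y*`, so `f`
vanishes on the range of `B`. The pairing of `(y*, B y*)` with `(μ f, ν e)` is `(e y*)² - ν (e y*) +
μν`, nonnegative when `ν² ≤ 4μν`. Thus `(f, e)` is related to `B` although `f` separates `e` from
the norm closure of the range, which excludes type (D). The pair `(f/2, 2e)` is also related to `B`
but not to `(f, e)`, which excludes uniqueness. The first obstruction survives transport along an
isomorphic embedding.

For the James space, a variation with weighted ends is subadditive under splicing. This gives the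
basis and the bounded sums of unit vectors. It also shows that `m` successive blocks have norm of
order `√m`, whereas a functional equal to 1 on each block takes the value `m` on their sum. Hence
the basis is shrinking. -/

noncomputable section

namespace MonotoneOp

universe u v

/-! ### Monotone graphs -/

section Graphs

variable {E : Type u} {F : Type v} [AddCommGroup E] [Module ℝ E] [AddCommGroup F] [Module ℝ F]
  {B : E →ₗ[ℝ] F →ₗ[ℝ] ℝ} {A : Set (E × F)}

/-- A monotone graph is maximal as soon as it contains every pair monotonically related to it. -/
lemma IsMonotone.isMaxMonotone (hA : IsMonotone B A)
    (h : ∀ p, (∀ q ∈ A, 0 ≤ B (p.1 - q.1) (p.2 - q.2)) → p ∈ A) : IsMaxMonotone B A :=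
  ⟨hA, fun _ hG hAG p hp => h p fun q hq => hG p hp q (hAG hq)⟩

/-- A maximally monotone graph contains every pair monotonically related to it. -/
lemma IsMaxMonotone.mem_of_related (hA : IsMaxMonotone B A) {p : E × F}
    (h : ∀ q ∈ A, 0 ≤ B (p.1 - q.1) (p.2 - q.2)) : p ∈ A := by
  refine hA.2 (y := insert p A) ?_ (Set.subset_insert p A) (Set.mem_insert p A)
  have h' : ∀ q ∈ A, 0 ≤ B (q.1 - p.1) (q.2 - p.2) := fun q hq => by
    have := h q hq
    rw [← neg_sub p.1, ← neg_sub p.2]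
    simpa only [map_neg, LinearMap.neg_apply, neg_neg] using this
  rintro q (rfl | hq) r (rfl | hr)
  · simp
  · exact h r hr
  · exact h' q hq
  · exact hA.1 q hq r hr

/-- Adding to a monotone graph a pair monotonically related to it keeps it monotone. -/
lemma IsMonotone.insert (hA : IsMonotone B A) {p : E × F}
    (h : ∀ q ∈ A, 0 ≤ B (q.1 - p.1) (q.2 - p.2)) : IsMonotone B (insert p A) := by
  have h' : ∀ q ∈ A, 0 ≤ B (p.1 - q.1) (p.2 - q.2) := fun q hq => by
    have := h q hq
    rw [← neg_sub q.1, ← neg_sub q.2]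
    simpa only [map_neg, LinearMap.neg_apply, neg_neg] using this
  rintro q (rfl | hq) r (rfl | hr)
  · simp
  · exact h' r hr
  · exact h q hq
  · exact hA q hq r hr

/-- Every monotone graph has a maximally monotone extension. -/
lemma IsMonotone.exists_isMaxMonotone (hA : IsMonotone B A) :
    ∃ G, A ⊆ G ∧ IsMaxMonotone B G := by
  refine zorn_subset_nonempty {G | IsMonotone B G} (fun c hc hchain _ => ?_) A hA
  refine ⟨⋃₀ c, ?_, fun s hs => Set.subset_sUnion_of_mem hs⟩
  rintro p ⟨s, hs, hp⟩ q ⟨t, ht, hq⟩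
  rcases hchain.total hs ht with hst | hts
  · exact hc ht p (hst hp) q hq
  · exact hc hs p hp q (hts hq)

end Graphs

/-- An affine function on `ℝ` that is bounded below is constant. -/
lemma eq_zero_of_forall_le_add_mul {a b c : ℝ} (h : ∀ t : ℝ, c ≤ a + t * b) : b = 0 := by
  by_contra hb
  have := h ((c - a - 1) / b)
  rw [div_mul_cancel₀ _ hb] at this
  linarith

/-! ### Weak* limits and criteria for failing type (D) or uniqueness -/

section Banach

variable {E : Type u} [NormedAddCommGroup E] [NormedSpace ℝ E]

lemma weakStarTendsto_iff {ι : Type*} {f : ι → StrongDual ℝ E} {l : Filter ι}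
    {x : StrongDual ℝ E} :
    WeakStarTendsto f l x ↔ ∀ y, Tendsto (fun i => f i y) l (𝓝 (x y)) :=
  tendsto_iff_forall_eval_tendsto_topDualPairing

/-- A bounded sequence in the dual has a weak* limit along the hyperfilter. -/
lemma exists_weakStar_hyperfilter_limit {f : ℕ → StrongDual ℝ E} {C : ℝ}
    (hf : ∀ n, ‖f n‖ ≤ C) :
    ∃ x : StrongDual ℝ E, ∀ y, Tendsto (fun n => f n y) (hyperfilter ℕ : Filter ℕ) (𝓝 (x y)) := by
  obtain ⟨x, -, hx⟩ := (WeakDual.isCompact_closedBall (𝕜 := ℝ) (0 : StrongDual ℝ E)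
    C).ultrafilter_le_nhds ((hyperfilter ℕ).map fun n => StrongDual.toWeakDual (f n)) (by
      rw [le_principal_iff]
      refine mem_map.2 (univ_mem' fun n => ?_)
      simpa using hf n)
  exact ⟨WeakDual.toStrongDual x, fun y => weakStarTendsto_iff.1 hx y⟩

variable {A : Set (E × StrongDual ℝ E)}

/-- An operator is not of type (D) if some functional vanishes on its range but not at the second
component of a pair monotonically related to it. -/
lemma not_isTypeD_of_related {x'' : StrongDual ℝ (StrongDual ℝ E)} {x' : StrongDual ℝ E}
    {f : StrongDual ℝ (StrongDual ℝ E)} (hrel : ∀ p ∈ A, 0 ≤ (incl p.1 - x'') (p.2 - x'))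
    (hf : ∀ p ∈ A, f p.2 = 0) (hx' : f x' ≠ 0) : ¬ IsTypeD A := by
  intro h
  obtain ⟨Γ, _, _, _, a, haA, -, -, ha⟩ := h x'' x' hrel
  have h1 := (f.continuous.tendsto x').comp ha
  have h2 : (f ∘ fun γ => (a γ).2) = fun _ => 0 := funext fun γ => hf _ (haA γ)
  rw [h2] at h1
  exact hx' (tendsto_nhds_unique h1 tendsto_const_nhds)

/-- An operator is not unique if two pairs of the bidual are monotonically related to it but not
to each other. -/
lemma not_isUnique_of_related (hA : MaxMonotone A)
    {p q : StrongDual ℝ (StrongDual ℝ E) × StrongDual ℝ E}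
    (hp : ∀ a ∈ A, 0 ≤ (incl a.1 - p.1) (a.2 - p.2))
    (hq : ∀ a ∈ A, 0 ≤ (incl a.1 - q.1) (a.2 - q.2))
    (hpq : (p.1 - q.1) (p.2 - q.2) < 0) : ¬ IsUnique A := by
  intro h
  set A' : Set (StrongDual ℝ (StrongDual ℝ E) × StrongDual ℝ E) :=
    (fun a => (incl a.1, a.2)) '' A with hA'
  have hmono : IsMonotone (topDualPairing ℝ (StrongDual ℝ E)) A' := by
    rintro _ ⟨a, ha, rfl⟩ _ ⟨c, hc, rfl⟩
    have := hA.1 a ha c hc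
    simpa [topDualPairing_apply] using this
  -- Zorn's lemma extends `A` together with `r`. If all maximal extensions coincided, `p` and `q`
  -- would lie in one monotone graph, against `hpq`.
  have key : ∀ r : StrongDual ℝ (StrongDual ℝ E) × StrongDual ℝ E,
      (∀ a ∈ A, 0 ≤ (incl a.1 - r.1) (a.2 - r.2)) →
      ∃ G, MaxMonotoneBidual G ∧ r ∈ G ∧ ∀ a ∈ A, (incl a.1, a.2) ∈ G := by
    intro r hr
    have h1 := IsMonotone.insert hmono (p := r) (by
      rintro _ ⟨a, ha, rfl⟩
      exact hr a ha)
    obtain ⟨G, hG, hGmax⟩ := h1.exists_isMaxMonotone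
    exact ⟨G, hGmax, hG (Set.mem_insert _ _), fun a ha =>
      hG (Set.mem_insert_of_mem _ ⟨a, ha, rfl⟩)⟩
  obtain ⟨G₁, hG₁, hp₁, hA₁⟩ := key p hp
  obtain ⟨G₂, hG₂, hq₂, hA₂⟩ := key q hq
  have := hG₁.1 p hp₁ q (h G₁ G₂ hG₁ hG₂ hA₁ hA₂ ▸ hq₂)
  exact absurd hpq (not_lt.2 this)

/-- A functional separating a point from a closed subspace. -/
lemma exists_dual_ne_zero_of_notMem {M : Submodule ℝ E} (hM : IsClosed (M : Set E)) {z : E}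
    (hz : z ∉ M) : ∃ f : StrongDual ℝ E, (∀ x ∈ M, f x = 0) ∧ f z ≠ 0 := by
  obtain ⟨f, u, hfu, hu⟩ := geometric_hahn_banach_closed_point M.convex hM hz
  have h0 : ∀ x ∈ M, f x = 0 := fun x hx =>
    neg_eq_zero.1 <| eq_zero_of_forall_le_add_mul (a := 0) (c := -u) fun t => by
      have := hfu (t • x) (M.smul_mem t hx)
      simp only [map_smul, smul_eq_mul] at this
      linarith
  refine ⟨f, h0, fun h => ?_⟩
  have := hfu 0 M.zero_mem
  rw [map_zero] at this
  linarith

/-- The graph of an operator on `E`, transported along `L : E → Z`. -/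
def pushforwardGraph {Z : Type v} [NormedAddCommGroup Z] [NormedSpace ℝ Z]
    (L : E →L[ℝ] Z) (A : Set (E × StrongDual ℝ E)) : Set (Z × StrongDual ℝ Z) :=
  {q | ∃ y, q.1 = L y ∧ (y, q.2.comp L) ∈ A}

/-! ### Transport of operators along an isomorphic embedding -/

section Embedding

variable {Z : Type v} [NormedAddCommGroup Z] [NormedSpace ℝ Z] {L : E →L[ℝ] Z}

/-- The adjoint of an isomorphic embedding is surjective. -/
lemma exists_comp_eq_of_isEmbedding (hL : IsEmbedding L) (f : StrongDual ℝ E) :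
    ∃ g : StrongDual ℝ Z, g.comp L = f := by
  let e := LinearEquiv.ofInjective (L : E →ₗ[ℝ] Z) hL.injective
  have he : Continuous e.symm := by
    have h := hL.toHomeomorph.symm.continuous
    refine h.congr fun z => ?_
    apply hL.toHomeomorph.injective
    rw [Homeomorph.apply_symm_apply]
    exact (e.apply_symm_apply z).symm
  obtain ⟨g, hg, -⟩ := exists_extension_norm_eq (𝕜 := ℝ) (L : E →ₗ[ℝ] Z).range
    (f.comp ⟨e.symm.toLinearMap, he⟩)
  refine ⟨g, ContinuousLinearMap.ext fun y => ?_⟩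
  have := hg (e y)
  simpa [e] using this

/-- The pushforward of a maximally monotone operator along an isomorphic embedding is maximally
monotone. -/
lemma MaxMonotone.pushforwardGraph [CompleteSpace E] (hL : IsEmbedding L)
    (hA : MaxMonotone A) : MaxMonotone (pushforwardGraph L A) := by
  refine IsMonotone.isMaxMonotone ?_ ?_
  · rintro ⟨_, p⟩ ⟨y, rfl, hy⟩ ⟨_, q⟩ ⟨w, rfl, hw⟩
    have := hA.1 _ hy _ hw
    simpa [topDualPairing_apply] using this
  · rintro ⟨z, z'⟩ hz
    have hAne : A.Nonempty := by
      by_contra hne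
      rw [Set.not_nonempty_iff_eq_empty] at hne
      have := hA.mem_of_related (p := 0) (by simp [hne])
      simp [hne] at this
    obtain ⟨⟨y₀, a₀⟩, ha₀⟩ := hAne
    obtain ⟨g₀, hg₀⟩ := exists_comp_eq_of_isEmbedding hL a₀
    have hclosed : IsClosed ((L : E →ₗ[ℝ] Z).range : Set Z) := by
      have h := (AddMonoidHom.isUniformInducing_of_isInducing hL.isInducing).isComplete_range
      convert! h.isClosed using 1
    have hzL : z ∈ (L : E →ₗ[ℝ] Z).range := by
      by_contra hzL
      obtain ⟨f, hf, hfz⟩ := exists_dual_ne_zero_of_notMem hclosed hzL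
      have hfL : f.comp L = 0 := ContinuousLinearMap.ext fun y => hf _ ⟨y, rfl⟩
      -- Since `f` vanishes on the range of `L`, all pairs `(L y₀, g₀ - t • f)` belong to the graph.
      -- Relatedness then bounds from below an affine function of `t` with slope `f z`.
      refine hfz (eq_zero_of_forall_le_add_mul (a := (z' - g₀) (z - L y₀)) (c := 0) fun t => ?_)
      have h1 := hz (L y₀, g₀ - t • f) ⟨y₀, rfl, by
        rw [ContinuousLinearMap.sub_comp, ContinuousLinearMap.smul_comp, hfL]
        simpa [hg₀] using ha₀⟩
      have h2 : f (L y₀) = 0 := hf _ ⟨y₀, rfl⟩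
      simp [topDualPairing_apply, h2] at h1
      simp only [_root_.sub_apply, map_sub]
      linarith
    obtain ⟨x, rfl⟩ := hzL
    refine ⟨x, rfl, hA.mem_of_related ?_⟩
    rintro ⟨y, a⟩ ha
    obtain ⟨g, rfl⟩ := exists_comp_eq_of_isEmbedding hL a
    have := hz (L y, g) ⟨y, rfl, ha⟩
    simpa [topDualPairing_apply] using this

/-- If the failure of type (D) of a maximally monotone operator is witnessed by a functional
vanishing on its range, then it passes to superspaces. -/
lemma not_isTypeDSpace_of_isEmbedding [CompleteSpace E] (hL : IsEmbedding L)
    (hA : MaxMonotone A) {x'' : StrongDual ℝ (StrongDual ℝ E)} {x' : StrongDual ℝ E}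
    {f : StrongDual ℝ (StrongDual ℝ E)} (hrel : ∀ p ∈ A, 0 ≤ (incl p.1 - x'') (p.2 - x'))
    (hf : ∀ p ∈ A, f p.2 = 0) (hx' : f x' ≠ 0) : ¬ IsTypeDSpace Z := by
  obtain ⟨z', rfl⟩ := exists_comp_eq_of_isEmbedding hL x'
  let Ladj : StrongDual ℝ Z →L[ℝ] StrongDual ℝ E := (ContinuousLinearMap.compL ℝ E Z ℝ).flip L
  have hLadj : ∀ g, Ladj g = g.comp L := fun g => rfl
  -- All pairings on `Z` that occur see functionals only through their restrictions along `L`, so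
  -- `x''` and `f` are composed with the adjoint and `x'` is replaced by an extension `z'`.
  refine fun h => not_isTypeD_of_related (x'' := x''.comp Ladj) (x' := z') (f := f.comp Ladj)
    ?_ ?_ ?_ (h _ (hA.pushforwardGraph hL))
  · rintro ⟨_, p⟩ ⟨y, rfl, hy⟩
    have := hrel _ hy
    simpa [hLadj] using this
  · rintro ⟨_, p⟩ ⟨y, rfl, hy⟩
    exact hf _ hy
  · exact hx'

end Embedding

end Banach

/-! ### Shrinking bases -/

section Basis

variable {X : Type u} [NormedAddCommGroup X] [NormedSpace ℝ X] {b : SchauderBasis ℝ X}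

lemma comp_proj_eq_sum (b : SchauderBasis ℝ X) (y : StrongDual ℝ X) (n : ℕ) :
    y.comp (b.proj n) = ∑ i ∈ Finset.range n, y (b i) • b.coord i := by
  ext x
  simp [mul_comm]

lemma sum_coord_basis (b : SchauderBasis ℝ X) (m k : ℕ) :
    ∑ i ∈ Finset.range k, b.coord m (b i) = if m < k then 1 else 0 := by
  have h : ∀ i, b.coord m (b i) = if m = i then 1 else 0 := fun i => by
    simp only [b.ortho, Pi.single_apply]
    congr
  simp only [h, Finset.sum_ite_eq, Finset.mem_range]

lemma incl_sum_apply (f : ℕ → X) (s : Finset ℕ) (y : StrongDual ℝ X) :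
    incl (∑ i ∈ s, f i) y = ∑ i ∈ s, y (f i) :=
  map_sum y f s

/-- For a shrinking basis, the adjoints of the basis projections converge pointwise in norm. -/
lemma IsShrinking.tendsto_comp_proj (hb : IsShrinking b) {C : ℝ} (hC : ∀ n, ‖b.proj n‖ ≤ C)
    (y : StrongDual ℝ X) : Tendsto (fun n => y.comp (b.proj n)) atTop (𝓝 y) := by
  have hC0 : 0 ≤ C := (norm_nonneg _).trans (hC 0)
  -- On the span the sequence is eventually constant; the uniform bound `C` carries convergence to
  -- the closure.
  have hspan : ∀ w ∈ Submodule.span ℝ (Set.range b.coord),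
      ∃ N, ∀ n ≥ N, w.comp (b.proj n) = w := by
    intro w hw
    induction hw using Submodule.span_induction with
    | mem w hw =>
      obtain ⟨i, rfl⟩ := hw
      refine ⟨i + 1, fun n hn => ?_⟩
      rw [comp_proj_eq_sum, Finset.sum_eq_single i]
      · simp [b.ortho]
      · intro j _ hj
        simp [b.ortho, hj.symm]
      · intro h
        exact absurd (Finset.mem_range.2 (by omega)) h
    | zero => exact ⟨0, fun n _ => ContinuousLinearMap.zero_comp _⟩
    | add v w _ _ hv hw =>
      obtain ⟨N, hN⟩ := hv
      obtain ⟨M, hM⟩ := hw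
      refine ⟨max N M, fun n hn => ?_⟩
      rw [ContinuousLinearMap.add_comp, hN n (by omega), hM n (by omega)]
    | smul r w _ hw =>
      obtain ⟨N, hN⟩ := hw
      exact ⟨N, fun n hn => by rw [ContinuousLinearMap.smul_comp, hN n hn]⟩
  rw [Metric.tendsto_atTop]
  intro ε hε
  have hy : y ∈ closure (Submodule.span ℝ (Set.range b.coord) : Set (StrongDual ℝ X)) := by
    rw [← Submodule.topologicalClosure_coe, hb]
    trivial
  obtain ⟨w, hw, hyw⟩ := Metric.mem_closure_iff.1 hy (ε / (C + 1)) (by positivity)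
  obtain ⟨N, hN⟩ := hspan w hw
  refine ⟨N, fun n hn => ?_⟩
  rw [dist_eq_norm] at hyw ⊢
  have h1 : y.comp (b.proj n) - y = (y - w).comp (b.proj n) - (y - w) := by
    rw [ContinuousLinearMap.sub_comp, hN n hn]
    abel
  rw [lt_div_iff₀ (by positivity)] at hyw
  calc ‖y.comp (b.proj n) - y‖ ≤ ‖(y - w).comp (b.proj n)‖ + ‖y - w‖ := h1 ▸ norm_sub_le _ _
    _ ≤ ‖y - w‖ * C + ‖y - w‖ := by
      gcongr
      exact (ContinuousLinearMap.opNorm_comp_le _ _).trans (by gcongr; exact hC n)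
    _ < ε := by linarith

/-- For a shrinking basis, the expansion of `x** ∈ X**` in the basis converges weak*. -/
lemma IsShrinking.tendsto_sum_bidual (hb : IsShrinking b) {C : ℝ} (hC : ∀ n, ‖b.proj n‖ ≤ C)
    (z : StrongDual ℝ (StrongDual ℝ X)) (y : StrongDual ℝ X) :
    Tendsto (fun k => ∑ n ∈ Finset.range k, z (b.coord n) * y (b n)) atTop (𝓝 (z y)) := by
  refine ((z.continuous.tendsto y).comp (hb.tendsto_comp_proj hC y)).congr fun k => ?_
  rw [Function.comp_apply, comp_proj_eq_sum]
  simp [mul_comm]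

/-- An element of the bidual is determined by its coordinates in a shrinking basis. -/
lemma IsShrinking.bidual_ext (hb : IsShrinking b) {C : ℝ} (hC : ∀ n, ‖b.proj n‖ ≤ C)
    {z w : StrongDual ℝ (StrongDual ℝ X)} (h : ∀ n, z (b.coord n) = w (b.coord n)) : z = w := by
  ext y
  refine tendsto_nhds_unique (hb.tendsto_sum_bidual hC z y) ?_
  simpa only [h] using hb.tendsto_sum_bidual hC w y

/-- For a shrinking basis whose partial sums are bounded, the partial sums converge weak*. -/
lemma IsShrinking.exists_weakStarTendsto_sum (hb : IsShrinking b) {C : ℝ}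
    (hC : ∀ n, ‖b.proj n‖ ≤ C) {K : ℝ} (hK : ∀ n, ‖∑ i ∈ Finset.range n, b i‖ ≤ K) :
    ∃ e : StrongDual ℝ (StrongDual ℝ X),
      WeakStarTendsto (fun n => incl (∑ i ∈ Finset.range n, b i)) atTop e := by
  obtain ⟨e, he⟩ := exists_weakStar_hyperfilter_limit
    (f := fun n => incl (∑ i ∈ Finset.range n, b i)) (C := K) fun n =>
      (double_dual_bound ℝ X _).trans (hK n)
  have hle : (hyperfilter ℕ : Filter ℕ) ≤ atTop := Nat.hyperfilter_le_atTop
  have hcoord : ∀ n, e (b.coord n) = 1 := fun n => by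
    refine tendsto_nhds_unique (he (b.coord n)) (Tendsto.mono_left ?_ hle)
    refine tendsto_const_nhds.congr' ?_
    filter_upwards [eventually_gt_atTop n] with N hN
    rw [incl_sum_apply, sum_coord_basis, if_pos hN]
  -- All coordinates of `e` being 1, its expansion consists of the given partial sums, so the
  -- ultrafilter limit is a limit of the whole sequence.
  refine ⟨e, weakStarTendsto_iff.2 fun y => ?_⟩
  refine (hb.tendsto_sum_bidual hC e y).congr fun k => ?_
  simp only [hcoord, one_mul, incl_sum_apply]

/-! ### The skew operator of a shrinking basis -/

section Operator

variable {e : StrongDual ℝ (StrongDual ℝ X)} {C : ℝ}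

lemma tendsto_sum_of_weakStarTendsto
    (he : WeakStarTendsto (fun n => incl (∑ i ∈ Finset.range n, b i)) atTop e)
    (y : StrongDual ℝ X) :
    Tendsto (fun n => ∑ i ∈ Finset.range n, y (b i)) atTop (𝓝 (e y)) := by
  simpa using weakStarTendsto_iff.1 he y

lemma coord_of_weakStarTendsto
    (he : WeakStarTendsto (fun n => incl (∑ i ∈ Finset.range n, b i)) atTop e) (n : ℕ) :
    e (b.coord n) = 1 := by
  refine tendsto_nhds_unique (tendsto_sum_of_weakStarTendsto he (b.coord n)) ?_
  refine tendsto_const_nhds.congr' ?_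
  filter_upwards [eventually_gt_atTop n] with N hN
  rw [sum_coord_basis, if_pos hN]

/-- The operator of the basis in coordinates. -/
lemma mem_basisOperator_iff
    (he : WeakStarTendsto (fun n => incl (∑ i ∈ Finset.range n, b i)) atTop e)
    (hb : IsShrinking b) (hC : ∀ n, ‖b.proj n‖ ≤ C)
    {p : StrongDual ℝ X × StrongDual ℝ (StrongDual ℝ X)} :
    p ∈ basisOperator b ↔ ∀ n, p.2 (b.coord n) =
      e p.1 - ∑ i ∈ Finset.range n, p.1 (b i) - ∑ i ∈ Finset.range (n + 1), p.1 (b i) := by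
  have htail : ∀ n, Tendsto (fun N => ∑ i ∈ Finset.Ioc n N, p.1 (b i)) atTop
      (𝓝 (e p.1 - ∑ i ∈ Finset.range (n + 1), p.1 (b i))) := fun n => by
    have h1 := ((tendsto_add_atTop_iff_nat 1).2
      (tendsto_sum_of_weakStarTendsto he p.1)).sub_const (∑ i ∈ Finset.range (n + 1), p.1 (b i))
    refine h1.congr' ?_
    filter_upwards [eventually_ge_atTop n] with N hN
    rw [← Finset.sum_Ico_eq_sub _ (Nat.succ_le_succ hN)]
    refine Finset.sum_congr ?_ fun _ _ => rfl
    ext i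
    simp only [Finset.mem_Ico, Finset.mem_Ioc]
    omega
  constructor
  · rintro ⟨t, ht, hp⟩ n
    have htn := tendsto_nhds_unique (ht n) (htail n)
    have h1 := weakStarTendsto_iff.1 hp (b.coord n)
    refine tendsto_nhds_unique h1 (tendsto_const_nhds.congr' ?_)
    filter_upwards [eventually_gt_atTop n] with N hN
    simp [b.ortho, Pi.single_apply, hN, htn]
    ring
  · intro h
    refine ⟨_, htail, weakStarTendsto_iff.2 fun y => ?_⟩
    refine (hb.tendsto_sum_bidual hC p.2 y).congr fun k => ?_
    rw [incl_sum_apply]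
    refine Finset.sum_congr rfl fun n _ => ?_
    rw [h n, map_smul, smul_eq_mul]
    ring

lemma isLinearOperator_basisOperator
    (he : WeakStarTendsto (fun n => incl (∑ i ∈ Finset.range n, b i)) atTop e)
    (hb : IsShrinking b) (hC : ∀ n, ‖b.proj n‖ ≤ C) :
    IsLinearOperator (basisOperator b) := by
  have hmem := @mem_basisOperator_iff X _ _ b e C he hb hC
  let S : Submodule ℝ (StrongDual ℝ X × StrongDual ℝ (StrongDual ℝ X)) :=
    { carrier := basisOperator b
      zero_mem' := hmem.2 fun n => by simp
      add_mem' := fun {p q} hp hq => hmem.2 fun n => by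
        have h1 := hmem.1 hp n
        have h2 := hmem.1 hq n
        simp only [Prod.fst_add, Prod.snd_add, _root_.add_apply, map_add,
          Finset.sum_add_distrib, h1, h2]
        ring
      smul_mem' := fun r p hp => hmem.2 fun n => by
        have h1 := hmem.1 hp n
        simp only [Prod.smul_fst, Prod.smul_snd, _root_.smul_apply, map_smul, smul_eq_mul,
          ← Finset.mul_sum, h1]
        ring }
  refine ⟨S.toLinearPMap, ?_⟩
  rw [Submodule.toLinearPMap_graph_eq]
  · rfl
  · intro p hp h0
    refine hb.bidual_ext hC fun n => ?_
    have := hmem.1 hp n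
    simpa [h0] using this

/-- With `s_n` the partial sums at `p.1`, the identity `(e - s_n - s_{n+1})(s_{n+1} - s_n) = (e
s_{n+1} - s_{n+1}²) - (e s_n - s_n²)` telescopes, and `s_k` tends to `e p.1`. -/
lemma apply_self_of_mem_basisOperator
    (he : WeakStarTendsto (fun n => incl (∑ i ∈ Finset.range n, b i)) atTop e)
    (hb : IsShrinking b) (hC : ∀ n, ‖b.proj n‖ ≤ C)
    {p : StrongDual ℝ X × StrongDual ℝ (StrongDual ℝ X)}
    (hp : p ∈ basisOperator b) : p.2 p.1 = 0 := by
  have hmem := (mem_basisOperator_iff he hb hC).1 hp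
  have hs := tendsto_sum_of_weakStarTendsto he p.1
  refine tendsto_nhds_unique (hb.tendsto_sum_bidual hC p.2 p.1) ?_
  have h1 : Tendsto (fun k => e p.1 * (∑ i ∈ Finset.range k, p.1 (b i)) -
      (∑ i ∈ Finset.range k, p.1 (b i)) ^ 2) atTop (𝓝 (e p.1 * e p.1 - e p.1 ^ 2)) :=
    (hs.const_mul _).sub (hs.pow 2)
  rw [show e p.1 * e p.1 - e p.1 ^ 2 = 0 by ring] at h1
  refine h1.congr fun k => ?_
  induction k with
  | zero => simp
  | succ k ih =>
    rw [Finset.sum_range_succ (fun n => p.2 (b.coord n) * p.1 (b n)), ← ih, hmem k,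
      Finset.sum_range_succ]
    ring

/-- A polarized form of `apply_self_of_mem_basisOperator`. -/
lemma apply_add_apply_of_mem_basisOperator
    (he : WeakStarTendsto (fun n => incl (∑ i ∈ Finset.range n, b i)) atTop e)
    (hb : IsShrinking b) (hC : ∀ n, ‖b.proj n‖ ≤ C)
    {p q : StrongDual ℝ X × StrongDual ℝ (StrongDual ℝ X)}
    (hp : p ∈ basisOperator b) (hq : q ∈ basisOperator b) : p.2 q.1 + q.2 p.1 = 0 := by
  obtain ⟨L, hL⟩ := isLinearOperator_basisOperator he hb hC
  have hpq : p + q ∈ basisOperator b := by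
    rw [← hL] at hp hq ⊢
    exact L.graph.add_mem hp hq
  have h1 := apply_self_of_mem_basisOperator he hb hC hpq
  have h2 := apply_self_of_mem_basisOperator he hb hC hp
  have h3 := apply_self_of_mem_basisOperator he hb hC hq
  simp only [Prod.fst_add, Prod.snd_add, _root_.add_apply, map_add] at h1
  linarith

lemma isSkew_basisOperator
    (he : WeakStarTendsto (fun n => incl (∑ i ∈ Finset.range n, b i)) atTop e)
    (hb : IsShrinking b) (hC : ∀ n, ‖b.proj n‖ ≤ C) :
    IsSkew (basisOperator b) := by
  intro p hp q hq
  have := apply_add_apply_of_mem_basisOperator he hb hC hp hq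
  simp only [_root_.neg_apply, dual_def]
  linarith

/-- The coordinate functionals lie in the domain. -/
lemma exists_coord_mem_basisOperator
    (he : WeakStarTendsto (fun n => incl (∑ i ∈ Finset.range n, b i)) atTop e)
    (hb : IsShrinking b) (hC : ∀ n, ‖b.proj n‖ ≤ C)
    (n : ℕ) :
    ∃ z, (b.coord n, z) ∈ basisOperator b ∧ ∀ x, z x =
      ∑ i ∈ Finset.range n, x (b i) + ∑ i ∈ Finset.range (n + 1), x (b i) - e x := by
  refine ⟨incl (∑ i ∈ Finset.range n, b i) + incl (∑ i ∈ Finset.range (n + 1), b i) - e, ?_,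
    fun x => by simp⟩
  -- Both sides are the sign of `n - m`.
  refine (mem_basisOperator_iff he hb hC).2 fun m => ?_
  simp only [_root_.sub_apply, _root_.add_apply, incl_sum_apply, sum_coord_basis,
    coord_of_weakStarTendsto he]
  split_ifs <;> first | omega | norm_num

/-- A pair whose pairing differences with the operator are bounded below lies in its graph. -/
lemma mem_basisOperator_of_le
    (he : WeakStarTendsto (fun n => incl (∑ i ∈ Finset.range n, b i)) atTop e)
    (hb : IsShrinking b) (hC : ∀ n, ‖b.proj n‖ ≤ C)
    {p : StrongDual ℝ X × StrongDual ℝ (StrongDual ℝ X)} {c : ℝ}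
    (h : ∀ q ∈ basisOperator b, c ≤ (p.2 - q.2) (p.1 - q.1)) : p ∈ basisOperator b := by
  obtain ⟨L, hL⟩ := isLinearOperator_basisOperator he hb hC
  refine (mem_basisOperator_iff he hb hC).2 fun n => ?_
  obtain ⟨z, hz, hzx⟩ := exists_coord_mem_basisOperator he hb hC n
  -- As `z (b.coord n) = 0`, testing with `t • (b.coord n, z)` gives no quadratic term in `t`, and
  -- the slope must vanish; that is the `n`-th coordinate equation.
  have h0 : p.2 (b.coord n) + z p.1 = 0 := by
    refine neg_eq_zero.1 (eq_zero_of_forall_le_add_mul (a := p.2 p.1) (c := c) fun t => ?_)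
    have ht : t • (b.coord n, z) ∈ basisOperator b := by
      rw [← hL] at hz ⊢
      exact L.graph.smul_mem t hz
    have h1 := h _ ht
    have h2 : z (b.coord n) = 0 := apply_self_of_mem_basisOperator he hb hC hz
    simp [h2] at h1
    linarith
  rw [hzx] at h0
  linarith

lemma maxMonotone_basisOperator
    (he : WeakStarTendsto (fun n => incl (∑ i ∈ Finset.range n, b i)) atTop e)
    (hb : IsShrinking b) (hC : ∀ n, ‖b.proj n‖ ≤ C) :
    MaxMonotone (basisOperator b) := by
  refine IsMonotone.isMaxMonotone ?_ fun p hp =>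
    mem_basisOperator_of_le he hb hC (c := 0) fun q hq => hp q hq
  intro p hp q hq
  have h1 := apply_add_apply_of_mem_basisOperator he hb hC hp hq
  have h2 := apply_self_of_mem_basisOperator he hb hC hp
  have h3 := apply_self_of_mem_basisOperator he hb hC hq
  rw [LinearMap.flip_apply, topDualPairing_apply]
  simp only [_root_.sub_apply, map_sub]
  linarith

/-- Any finite lower bound already puts the pair in the graph, so it serves as its own
approximation. -/
lemma isTypeBR_basisOperator
    (he : WeakStarTendsto (fun n => incl (∑ i ∈ Finset.range n, b i)) atTop e)
    (hb : IsShrinking b) (hC : ∀ n, ‖b.proj n‖ ≤ C) :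
    IsTypeBR (basisOperator b) := by
  rintro x x' α β hα hβ ⟨c, -, hc⟩
  exact ⟨(x, x'), mem_basisOperator_of_le he hb hC (p := (x, x')) hc, by simpa, by simpa⟩

/-! ### The rank one perturbation -/

lemma maxMonotone_addRankOne
    (he : WeakStarTendsto (fun n => incl (∑ i ∈ Finset.range n, b i)) atTop e)
    (hb : IsShrinking b) (hC : ∀ n, ‖b.proj n‖ ≤ C) :
    MaxMonotone (addRankOne (basisOperator b) e) := by
  obtain ⟨L, hL⟩ := isLinearOperator_basisOperator he hb hC
  have hmem := @mem_basisOperator_iff X _ _ b e C he hb hC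
  refine IsMonotone.isMaxMonotone ?_ ?_
  · rintro ⟨x, x'⟩ ⟨z, hz, hx'⟩ ⟨y, y'⟩ ⟨w, hw, hy'⟩
    simp only at hz hx' hw hy'
    subst hx' hy'
    have h1 := apply_add_apply_of_mem_basisOperator he hb hC hz hw
    have h2 := apply_self_of_mem_basisOperator he hb hC hz
    have h3 := apply_self_of_mem_basisOperator he hb hC hw
    rw [LinearMap.flip_apply, topDualPairing_apply]
    simp only [_root_.sub_apply, map_sub,
      _root_.add_apply, _root_.smul_apply, smul_eq_mul] at h1 h2 h3 ⊢
    nlinarith [sq_nonneg (e x - e y)]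
  · rintro ⟨x, w⟩ hrel
    have hrel' : ∀ q ∈ basisOperator b, 0 ≤ (w - (q.2 + e q.1 • e)) (x - q.1) := fun q hq =>
      hrel (q.1, q.2 + e q.1 • e) ⟨q.2, hq, rfl⟩
    have hcoord := coord_of_weakStarTendsto he
    choose z hz hzx using exists_coord_mem_basisOperator he hb hC
    -- The functional `e` vanishes on `b.coord n - b.coord 0`, so in these directions the rank one
    -- term disappears and the test is again affine. The defect in the coordinate equation is
    -- therefore a constant `μ`, and `w - μ • e` is the value of the unperturbed operator at `x`.
    have hconst : ∀ n, w (b.coord n) + z n x = w (b.coord 0) + z 0 x := by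
      intro n
      rw [← sub_eq_zero, ← neg_eq_zero]
      refine eq_zero_of_forall_le_add_mul (a := w x) (c := 0) fun t => ?_
      have ht : t • ((b.coord n, z n) - (b.coord 0, z 0)) ∈ basisOperator b := by
        have hn := hz n
        have h0 := hz 0
        rw [← hL] at hn h0 ⊢
        exact L.graph.smul_mem t (L.graph.sub_mem hn h0)
      have h1 := hrel' _ ht
      have h2 := apply_self_of_mem_basisOperator he hb hC ht
      simp only [Prod.fst_sub, Prod.snd_sub, Prod.smul_fst, Prod.smul_snd, _root_.sub_apply,
        _root_.add_apply, _root_.smul_apply, map_sub, map_smul, smul_eq_mul, hcoord] at h1 h2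
      linarith
    set μ : ℝ := w (b.coord 0) + z 0 x with hμ
    have hmemμ : (x, w - μ • e) ∈ basisOperator b := hmem.2 fun n => by
      have h1 := hconst n
      rw [hzx] at h1
      simp only [_root_.sub_apply, _root_.smul_apply, hcoord, smul_eq_mul]
      linarith
    have hμe : μ = e x := by
      have hquad : ∀ t : ℝ, 0 ≤ t * (μ - e x) + t ^ 2 := by
        intro t
        have ht : (x, w - μ • e) - t • (b.coord 0, z 0) ∈ basisOperator b := by
          have h0 := hz 0
          have h1 := hmemμ
          rw [← hL] at h0 h1 ⊢
          exact L.graph.sub_mem h1 (L.graph.smul_mem t h0)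
        have h1 := hrel' _ ht
        have h2 : z 0 (b.coord 0) = 0 := apply_self_of_mem_basisOperator he hb hC (hz 0)
        simp only [Prod.fst_sub, Prod.snd_sub, Prod.smul_fst, Prod.smul_snd, _root_.sub_apply,
          _root_.add_apply, _root_.smul_apply, map_sub, map_smul, smul_eq_mul, hcoord, h2] at h1
        linarith
      -- The minimum of the quadratic is `-(μ - e x)² / 4`.
      have := hquad (-(μ - e x) / 2)
      nlinarith [sq_nonneg (μ - e x)]
    refine ⟨w - μ • e, hmemμ, ?_⟩
    rw [← hμe]
    simp

/-- A functional on the bidual that takes the value `1` at `e` and whose values on the graph of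
the operator are known: a limit of the coordinate functionals. -/
lemma exists_limit_functional
    (he : WeakStarTendsto (fun n => incl (∑ i ∈ Finset.range n, b i)) atTop e)
    (hb : IsShrinking b) (hC : ∀ n, ‖b.proj n‖ ≤ C)
    {K : ℝ} (hK : ∀ n, ‖b.coord n‖ ≤ K) :
    ∃ f : StrongDual ℝ (StrongDual ℝ (StrongDual ℝ X)), f e = 1 ∧
      ∀ p ∈ basisOperator b, f p.2 = -e p.1 := by
  obtain ⟨f, hf⟩ := exists_weakStar_hyperfilter_limit (f := fun n => incl (b.coord n)) (C := K)
    fun n => (double_dual_bound ℝ _ _).trans (hK n)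
  have hle : (hyperfilter ℕ : Filter ℕ) ≤ atTop := Nat.hyperfilter_le_atTop
  refine ⟨f, ?_, fun p hp => ?_⟩
  · refine tendsto_nhds_unique (hf e) ?_
    simp [coord_of_weakStarTendsto he]
  · refine tendsto_nhds_unique (hf p.2) (Tendsto.mono_left ?_ hle)
    have hs := tendsto_sum_of_weakStarTendsto he p.1
    -- The `n`-th coordinate `e p.1 - s_n - s_{n+1}` tends to `e p.1 - 2 e p.1`.
    have h1 := (hs.const_sub (e p.1)).sub ((tendsto_add_atTop_iff_nat 1).2 hs)
    rw [sub_self, zero_sub] at h1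
    refine h1.congr fun n => ?_
    rw [dual_def, (mem_basisOperator_iff he hb hC).1 hp n]

/-- The perturbed operator vanishes under the limit functional `f`, and `(μ • f, ν • e)` is
monotonically related to it when `ν² ≤ 4 μ ν`. -/
lemma related_addRankOne
    (he : WeakStarTendsto (fun n => incl (∑ i ∈ Finset.range n, b i)) atTop e)
    (hb : IsShrinking b) (hC : ∀ n, ‖b.proj n‖ ≤ C)
    {f : StrongDual ℝ (StrongDual ℝ (StrongDual ℝ X))} (hfe : f e = 1)
    (hf : ∀ p ∈ basisOperator b, f p.2 = -e p.1)
    {p : StrongDual ℝ X × StrongDual ℝ (StrongDual ℝ X)}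
    (hp : p ∈ addRankOne (basisOperator b) e) :
    f p.2 = 0 ∧ ∀ μ ν : ℝ, ν ^ 2 ≤ 4 * (μ * ν) → 0 ≤ (incl p.1 - μ • f) (p.2 - ν • e) := by
  obtain ⟨y, y'⟩ := p
  obtain ⟨z, hz, hy'⟩ := hp
  simp only at hz hy'
  subst hy'
  have h1 := hf _ hz
  have h2 := apply_self_of_mem_basisOperator he hb hC hz
  have h0 : f (z + e y • e) = 0 := by
    simp only [map_add, map_smul, h1, hfe, smul_eq_mul]
    ring
  refine ⟨h0, fun μ ν hμν => ?_⟩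
  simp only [_root_.sub_apply, _root_.smul_apply, dual_def, _root_.add_apply, map_sub,
    map_smul, smul_eq_mul, h0, hfe] at h2 ⊢
  -- Four times the pairing is `(2 e y - ν)² + 4μν - ν²`.
  nlinarith [sq_nonneg (2 * e y - ν)]

end Operator

end Basis

/-! ### The unit vector basis of the James space -/

/-- The squared variation of `x` along `s 0 < ⋯ < s k`. -/
def variation (s : ℕ → ℕ) (k : ℕ) (x : ℕ → ℝ) : ℝ :=
  ∑ i ∈ Finset.range k, (x (s i) - x (s (i + 1))) ^ 2

/-- The squared variation of `x` along `s 0 < ⋯ < s k` with weighted end terms. Unlike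
`variation`, it is subadditive under concatenation of chains. -/
def endVariation (s : ℕ → ℕ) (k : ℕ) (x : ℕ → ℝ) : ℝ :=
  2 * x (s 0) ^ 2 + variation s k x + 2 * x (s k) ^ 2

/-- The sequence that agrees with `x` before `N` and with `y` from `N` on. -/
def splice (N : ℕ) (x y : ℕ → ℝ) (i : ℕ) : ℝ := if i < N then x i else y i

/-! ### Variation along chains and splicing of sequences -/

section Variation

variable {s : ℕ → ℕ} {k N : ℕ} {x y : ℕ → ℝ}

lemma chainNorm_eq_sqrt_variation (c : Chain) (x : ℕ → ℝ) :
    chainNorm c x = √(variation c.2.1 c.1 x) := rfl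

lemma variation_le_endVariation : variation s k x ≤ endVariation s k x := by
  unfold endVariation
  nlinarith [sq_nonneg (x (s 0)), sq_nonneg (x (s k))]

lemma variation_congr {s' : ℕ → ℕ} (h : ∀ i ≤ k, x (s i) = y (s' i)) :
    variation s k x = variation s' k y := by
  refine Finset.sum_congr rfl fun i hi => ?_
  rw [Finset.mem_range] at hi
  rw [h i hi.le, h (i + 1) hi]

lemma endVariation_congr {s' : ℕ → ℕ} (h : ∀ i ≤ k, x (s i) = y (s' i)) :
    endVariation s k x = endVariation s' k y := by
  unfold endVariation
  rw [variation_congr h, h 0 (Nat.zero_le k), h k le_rfl]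

lemma variation_split (s : ℕ → ℕ) (m r : ℕ) (x : ℕ → ℝ) :
    variation s (m + 1 + r) x = variation s m x + (x (s m) - x (s (m + 1))) ^ 2 +
      variation (fun i => s (m + 1 + i)) r x := by
  unfold variation
  rw [Finset.sum_range_add, Finset.sum_range_succ]
  rfl

/-- The one difference crossing the cut satisfies `(u - v)² ≤ 2u² + 2v²`; the weight 2 at the ends
is chosen to absorb it. -/
lemma endVariation_split_le (s : ℕ → ℕ) (m r : ℕ) (x : ℕ → ℝ) :
    endVariation s (m + 1 + r) x ≤
      endVariation s m x + endVariation (fun i => s (m + 1 + i)) r x := by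
  unfold endVariation
  rw [variation_split]
  simp only [add_zero]
  nlinarith [sq_nonneg (x (s m) + x (s (m + 1)))]

/-- A chain lies before `N`, lies beyond it, or crosses `N` once, and in the last case it is cut at
its first index beyond `N`. Only chains starting beyond `N` are needed for `y`. -/
lemma endVariation_splice_le (hs : StrictMono s) {a b : ℝ} (ha : 0 ≤ a) (hb : 0 ≤ b)
    (hx : ∀ s k, StrictMono s → endVariation s k x ≤ a)
    (hy : ∀ s k, StrictMono s → N ≤ s 0 → endVariation s k y ≤ b) :
    endVariation s k (splice N x y) ≤ a + b := by
  rcases lt_or_ge (s k) N with hk | hk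
  · have : endVariation s k (splice N x y) = endVariation s k x :=
      endVariation_congr fun i hi => if_pos ((hs.monotone hi).trans_lt hk)
    linarith [hx s k hs]
  · rcases le_or_gt N (s 0) with h0 | h0
    · have : endVariation s k (splice N x y) = endVariation s k y :=
        endVariation_congr fun i _ => if_neg (not_lt.2 (h0.trans (hs.monotone (Nat.zero_le i))))
      linarith [hy s k hs h0]
    · classical
      have hex : ∃ j, N ≤ s j := ⟨k, hk⟩
      obtain ⟨m, hm⟩ : ∃ m, Nat.find hex = m + 1 :=
        Nat.exists_eq_succ_of_ne_zero fun h => absurd (h ▸ Nat.find_spec hex) (not_le.2 h0)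
      have hm1 : N ≤ s (m + 1) := hm ▸ Nat.find_spec hex
      have hm0 : s m < N := not_le.1 (Nat.find_min hex (by omega))
      obtain ⟨r, rfl⟩ : ∃ r, k = m + 1 + r :=
        Nat.exists_eq_add_of_le (hm ▸ Nat.find_min' hex hk)
      have hs' : StrictMono fun i => s (m + 1 + i) := fun i j hij => hs (by omega)
      refine (endVariation_split_le s m r _).trans (add_le_add ?_ ?_)
      · rw [endVariation_congr (s' := s) (y := x)
          fun i hi => if_pos ((hs.monotone hi).trans_lt hm0)]
        exact hx s m hs
      · rw [endVariation_congr (s' := fun i => s (m + 1 + i)) (y := y)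
          fun i _ => if_neg (not_lt.2 (hm1.trans (hs.monotone (Nat.le_add_right _ _))))]
        exact hy _ r hs' hm1

@[simp]
lemma endVariation_zero : endVariation s k 0 = 0 := by
  simp [endVariation, variation]

@[simp]
lemma endVariation_one : endVariation s k 1 = 4 := by
  simp [endVariation, variation]
  norm_num

end Variation

/-! ### Norm estimates, basis expansion and shrinking property -/

namespace James

lemma variation_le (x : James) {s : ℕ → ℕ} (hs : StrictMono s) (k : ℕ) :
    variation s k x.toSeq ≤ ‖x‖ ^ 2 := by
  have h := le_ciSup x.bddAbove (k, ⟨s, hs⟩)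
  rw [← norm_def, chainNorm_eq_sqrt_variation] at h
  exact (Real.sqrt_le_left (norm_nonneg x)).1 h

lemma abs_toSeq_le (x : James) (n : ℕ) : |x.toSeq n| ≤ ‖x‖ := by
  have h : Tendsto (fun m => |x.toSeq n - x.toSeq m|) atTop (𝓝 |x.toSeq n - 0|) :=
    (x.tendsto_toSeq.const_sub _).abs
  rw [sub_zero] at h
  refine le_of_tendsto h ?_
  filter_upwards [eventually_gt_atTop n] with m hm
  exact x.abs_sub_le hm

/-- The constant is `2 + 1 + 2`. Together with `norm_le_of_endVariation_le` this makes the weighted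
variation equivalent to the squared norm. -/
lemma endVariation_le (x : James) {s : ℕ → ℕ} (hs : StrictMono s) (k : ℕ) :
    endVariation s k x.toSeq ≤ 5 * ‖x‖ ^ 2 := by
  have h := fun n => sq_le_sq' (abs_le.1 (x.abs_toSeq_le n)).1 (abs_le.1 (x.abs_toSeq_le n)).2
  unfold endVariation
  linarith [x.variation_le hs k, h (s 0), h (s k)]

lemma norm_le_of_endVariation_le {x : James} {M : ℝ} (hM : 0 ≤ M)
    (h : ∀ s k, StrictMono s → endVariation s k x.toSeq ≤ M ^ 2) : ‖x‖ ≤ M := by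
  rw [norm_def]
  refine ciSup_le fun c => ?_
  rw [chainNorm_eq_sqrt_variation, Real.sqrt_le_left hM]
  exact variation_le_endVariation.trans (h _ _ c.2.2)

/-- A null sequence of bounded variation, as an element of the James space. -/
def ofSeq (x : ℕ → ℝ) (hx : Tendsto x atTop (𝓝 0)) (M : ℝ)
    (h : ∀ s k, StrictMono s → endVariation s k x ≤ M) : James :=
  ⟨x, hx, √M, by
    rintro _ ⟨c, rfl⟩
    exact Real.sqrt_le_sqrt (variation_le_endVariation.trans (h _ _ c.2.2))⟩

lemma single_eq_splice (n : ℕ) :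
    (Pi.single n 1 : ℕ → ℝ) = splice n 0 (splice (n + 1) 1 0) := by
  ext i
  simp only [splice, Pi.single_apply, Pi.zero_apply, Pi.one_apply]
  split_ifs <;> first | omega | rfl

/-- The unit vectors. -/
def unitVector (n : ℕ) : James :=
  ofSeq (Pi.single n 1)
    (tendsto_const_nhds.congr' (by
      filter_upwards [eventually_gt_atTop n] with m hm
      simp [hm.ne']))
    4 (fun s k hs => by
      rw [single_eq_splice]
      refine (endVariation_splice_le hs le_rfl (by norm_num : (0 : ℝ) ≤ 4) (by simp)
        fun s k hs _ => ?_).trans (by norm_num)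
      exact (endVariation_splice_le hs (by norm_num : (0 : ℝ) ≤ 4) le_rfl (by simp)
        (by simp)).trans (by norm_num))

lemma toSeq_unitVector (n : ℕ) : (unitVector n).toSeq = Pi.single n 1 := rfl

/-- The coordinate functionals. -/
def coordinate (n : ℕ) : StrongDual ℝ James :=
  LinearMap.mkContinuous
    { toFun := fun x => x.toSeq n
      map_add' := fun _ _ => rfl
      map_smul' := fun _ _ => rfl } 1 fun x => by
        rw [one_mul]
        exact x.abs_toSeq_le n

lemma coordinate_apply (n : ℕ) (x : James) : coordinate n x = x.toSeq n := rfl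

lemma norm_coordinate_le (n : ℕ) : ‖coordinate n‖ ≤ 1 :=
  LinearMap.mkContinuous_norm_le _ zero_le_one _

lemma toSeq_sub (x y : James) : (x - y).toSeq = x.toSeq - y.toSeq := rfl

lemma toSeq_sum_smul_unitVector (c : ℕ → ℝ) (n : ℕ) :
    (∑ i ∈ Finset.range n, c i • unitVector i).toSeq = splice n c 0 := by
  ext j
  rw [← coordinate_apply, map_sum]
  simp [coordinate_apply, toSeq_unitVector, splice, Pi.single_apply]

/-- The tails of an element of the James space have small variation. -/
lemma exists_variation_tail_le (x : James) {ε : ℝ} (hε : 0 < ε) :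
    ∃ N, ∀ s k, StrictMono s → N ≤ s 0 → variation s k x.toSeq ≤ ε := by
  have hbdd : BddAbove (Set.range fun c : Chain => variation c.2.1 c.1 x.toSeq) :=
    ⟨‖x‖ ^ 2, by rintro _ ⟨c, rfl⟩; exact x.variation_le c.2.2 _⟩
  obtain ⟨⟨m, s, hs⟩, hc⟩ := exists_lt_of_lt_ciSup
    (sub_lt_self (⨆ c : Chain, variation c.2.1 c.1 x.toSeq) hε)
  refine ⟨s m + 1, fun t r ht hNt => ?_⟩
  -- The chain `s` is within `ε` of the supremum, so a later chain `t` appended to it can contribute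
  -- at most `ε`.
  let u : ℕ → ℕ := fun i => if i ≤ m then s i else t (i - (m + 1))
  have hu : StrictMono u := strictMono_nat_of_lt_succ fun i => by
    simp only [u]
    rcases lt_trichotomy i m with h | rfl | h
    · rw [if_pos h.le, if_pos (by omega)]
      exact hs (Nat.lt_succ_self i)
    · rw [if_pos le_rfl, if_neg (by omega), Nat.sub_self]
      omega
    · rw [if_neg (by omega), if_neg (by omega)]
      exact ht (by omega)
  have h1 := le_ciSup hbdd (m + 1 + r, ⟨u, hu⟩)
  have h2 : variation u m x.toSeq = variation s m x.toSeq :=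
    variation_congr fun i hi => by rw [show u i = s i from if_pos hi]
  have h3 : variation (fun i => u (m + 1 + i)) r x.toSeq = variation t r x.toSeq :=
    variation_congr fun i _ => by
      rw [show u (m + 1 + i) = t i by
        simp only [u]
        rw [if_neg (by omega), Nat.add_sub_cancel_left]]
  simp only [variation_split, h2, h3] at h1 hc
  nlinarith [sq_nonneg (x.toSeq (u m) - x.toSeq (u (m + 1)))]

lemma tendsto_sum_unitVector (x : James) :
    Tendsto (fun n => ∑ i ∈ Finset.range n, x.toSeq i • unitVector i) atTop (𝓝 x) := by
  rw [Metric.tendsto_atTop]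
  intro ε hε
  have hδ : 0 < ε / 4 := by positivity
  obtain ⟨N, hN⟩ := x.exists_variation_tail_le (ε := (ε / 4) ^ 2) (by positivity)
  obtain ⟨M, hM⟩ := Metric.tendsto_atTop.1 x.tendsto_toSeq (ε / 4) hδ
  refine ⟨max N M, fun n hn => ?_⟩
  rw [dist_comm, dist_eq_norm]
  -- With `δ = ε / 4`, the tail has weighted variation at most `2δ² + δ² + 2δ² ≤ (3δ)²`.
  refine lt_of_le_of_lt (norm_le_of_endVariation_le (M := 3 * (ε / 4)) (by positivity)
    fun s k hs => ?_) (by linarith)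
  have h1 : (x - ∑ i ∈ Finset.range n, x.toSeq i • unitVector i).toSeq =
      splice n 0 x.toSeq := by
    rw [toSeq_sub, toSeq_sum_smul_unitVector]
    ext i
    simp only [splice, Pi.sub_apply, Pi.zero_apply]
    split_ifs <;> ring
  rw [h1]
  refine (endVariation_splice_le hs le_rfl (b := (3 * (ε / 4)) ^ 2) (by positivity)
    (by simp) fun s k hs hns => ?_).trans (by simp)
  have h2 := hN s k hs (by omega)
  have h3 : ∀ i, x.toSeq (s i) ^ 2 ≤ (ε / 4) ^ 2 := fun i => by
    have h4 := hM (s i) (by have := hs.monotone (Nat.zero_le i); omega)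
    rw [Real.dist_0_eq_abs] at h4
    exact sq_le_sq' (abs_le.1 h4.le).1 (abs_le.1 h4.le).2
  unfold endVariation
  nlinarith [h3 0, h3 k]

/-- The unit vector basis of the James space. -/
def unitBasis : SchauderBasis ℝ James where
  basis := unitVector
  coord := coordinate
  ortho i j := by
    rw [coordinate_apply, toSeq_unitVector]
    simp only [Pi.single_apply]
    congr
  expansion x := by
    rw [HasSum, SummationFilter.conditional_filter_eq_map_range, tendsto_map'_iff]
    exact x.tendsto_sum_unitVector

lemma unitBasis_apply (n : ℕ) : unitBasis n = unitVector n := rfl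

lemma unitBasis_proj_apply (n : ℕ) (x : James) :
    unitBasis.proj n x = ∑ i ∈ Finset.range n, x.toSeq i • unitVector i :=
  SchauderBasis.proj_apply _ n x

lemma norm_unitBasis_proj_le (n : ℕ) : ‖unitBasis.proj n‖ ≤ 3 := by
  refine ContinuousLinearMap.opNorm_le_bound _ (by norm_num) fun x => ?_
  refine norm_le_of_endVariation_le (by positivity) fun s k hs => ?_
  rw [unitBasis_proj_apply, toSeq_sum_smul_unitVector]
  refine (endVariation_splice_le hs (by positivity) le_rfl
    (fun s k hs => x.endVariation_le hs k) (by simp)).trans ?_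
  nlinarith [sq_nonneg ‖x‖]

lemma norm_sum_unitBasis_le (n : ℕ) : ‖∑ i ∈ Finset.range n, unitBasis i‖ ≤ 2 := by
  refine norm_le_of_endVariation_le (by norm_num) fun s k hs => ?_
  have h := toSeq_sum_smul_unitVector 1 n
  simp only [Pi.one_apply, one_smul] at h
  simp only [unitBasis_apply, h]
  exact (endVariation_splice_le hs (by norm_num : (0 : ℝ) ≤ 4) le_rfl (by simp)
    (by simp)).trans (by norm_num)

/-- A functional on the James space is small on vectors supported far out: otherwise sums of
disjoint blocks would contradict its boundedness. -/
lemma exists_tail_apply_le (f : StrongDual ℝ James) {ε : ℝ} (hε : 0 < ε) :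
    ∃ N, ∀ x : James, (∀ i < N, x.toSeq i = 0) → |f x| ≤ ε * ‖x‖ := by
  by_contra! hcon
  -- A counterexample supported beyond `N` remains one after a long truncation, by continuity, and
  -- is then scaled so that `f` equals 1.
  have hblock : ∀ N, ∃ y : James, (∀ i < N, y.toSeq i = 0) ∧ (∃ M, ∀ i ≥ M, y.toSeq i = 0) ∧
      f y = 1 ∧ ‖y‖ ≤ ε⁻¹ := by
    intro N
    obtain ⟨x, hx, hfx⟩ := hcon N
    have hlim := x.tendsto_sum_unitVector
    obtain ⟨M, hM⟩ := ((hlim.norm.const_mul ε).eventually_lt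
      ((f.continuous.tendsto x).comp hlim).abs hfx).exists
    set w := ∑ i ∈ Finset.range M, x.toSeq i • unitVector i with hw
    have hws : w.toSeq = splice M x.toSeq 0 := toSeq_sum_smul_unitVector _ M
    change ε * ‖w‖ < |f w| at hM
    have hfw : 0 < |f w| := lt_of_le_of_lt (by positivity) hM
    refine ⟨(f w)⁻¹ • w, fun i hi => ?_, ⟨M, fun i hi => ?_⟩, ?_, ?_⟩
    · simp [toSeq_smul, hws, splice, hx i hi]
    · simp [toSeq_smul, hws, splice, not_lt.2 hi]
    · rw [map_smul, smul_eq_mul, inv_mul_cancel₀ (abs_pos.1 hfw)]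
    · rw [norm_smul, norm_inv, Real.norm_eq_abs, inv_mul_le_iff₀ hfw, ← div_eq_mul_inv,
        le_div_iff₀ hε]
      linarith
  -- Each new block starts after the previous ones end, so the sum is a splice and weighted
  -- variations add: the squared norm grows at most linearly in `m`.
  have hsum : ∀ m : ℕ, ∃ x : James, (∃ N, ∀ i ≥ N, x.toSeq i = 0) ∧ f x = m ∧
      ∀ s k, StrictMono s → endVariation s k x.toSeq ≤ m * (5 * (ε⁻¹) ^ 2) := by
    intro m
    induction m with
    | zero => exact ⟨0, ⟨0, fun _ _ => rfl⟩, by simp, fun s k _ => by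
        rw [show (0 : James).toSeq = 0 from rfl]; simp⟩
    | succ m ih =>
      obtain ⟨x, ⟨N, hN⟩, hfx, hx⟩ := ih
      obtain ⟨y, hy, ⟨M, hM⟩, hfy, hyn⟩ := hblock N
      refine ⟨x + y, ⟨max N M, fun i hi => ?_⟩, by simp [hfx, hfy], fun s k hs => ?_⟩
      · simp [toSeq_add, hN i (le_of_max_le_left hi), hM i (le_of_max_le_right hi)]
      · have h1 : (x + y).toSeq = splice N x.toSeq y.toSeq := by
          ext i
          simp only [toSeq_add, splice, Pi.add_apply]
          split_ifs with h
          · rw [hy i h, add_zero]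
          · rw [hN i (not_lt.1 h), zero_add]
        rw [h1]
        refine (endVariation_splice_le hs (by positivity) (by positivity) hx
          fun s k hs _ => (y.endVariation_le hs k).trans
            (show _ ≤ 5 * (ε⁻¹) ^ 2 by gcongr)).trans (le_of_eq ?_)
        push_cast
        ring
  -- Boundedness of `f` would give `m² ≤ ‖f‖² · m · 5ε⁻²`, which fails for this `m`.
  obtain ⟨m, hm⟩ := exists_nat_gt (‖f‖ ^ 2 * (5 * (ε⁻¹) ^ 2))
  obtain ⟨x, -, hfx, hx⟩ := hsum m
  have hm0 : (0 : ℝ) < m := lt_of_le_of_lt (by positivity) hm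
  have hxn : ‖x‖ ≤ √(m * (5 * (ε⁻¹) ^ 2)) :=
    norm_le_of_endVariation_le (Real.sqrt_nonneg _) fun s k hs => by
      rw [Real.sq_sqrt (by positivity)]
      exact hx s k hs
  have h1 : (m : ℝ) ≤ ‖f‖ * √(m * (5 * (ε⁻¹) ^ 2)) := by
    calc (m : ℝ) = f x := hfx.symm
      _ ≤ ‖f x‖ := le_abs_self _
      _ ≤ ‖f‖ * ‖x‖ := f.le_opNorm x
      _ ≤ _ := by gcongr
  have h2 : (m : ℝ) ^ 2 ≤ ‖f‖ ^ 2 * (m * (5 * (ε⁻¹) ^ 2)) := by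
    calc (m : ℝ) ^ 2 ≤ (‖f‖ * √(m * (5 * (ε⁻¹) ^ 2))) ^ 2 := by gcongr
      _ = _ := by rw [mul_pow, Real.sq_sqrt (by positivity)]
  nlinarith

lemma isShrinking_unitBasis : IsShrinking unitBasis := by
  refine (Submodule.eq_top_iff'.2 fun f => ?_)
  refine Metric.mem_closure_iff.2 fun ε hε => ?_
  -- The complementary projection has norm at most `1 + 3 = 4`, so `ε / 8` leads to the bound `ε /
  -- 2`.
  obtain ⟨N, hN⟩ := exists_tail_apply_le f (ε := ε / 8) (by positivity)
  refine ⟨f.comp (unitBasis.proj N), ?_, ?_⟩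
  · rw [comp_proj_eq_sum]
    exact Submodule.sum_mem _ fun i _ => Submodule.smul_mem _ _ (Submodule.subset_span ⟨i, rfl⟩)
  · rw [dist_eq_norm]
    refine lt_of_le_of_lt (ContinuousLinearMap.opNorm_le_bound _ (M := ε / 2) (by positivity)
      fun x => ?_) (by linarith)
    have h1 := hN (x - unitBasis.proj N x) fun i hi => by
      rw [toSeq_sub, unitBasis_proj_apply, toSeq_sum_smul_unitVector]
      simp [splice, hi]
    have h2 : ‖x - unitBasis.proj N x‖ ≤ 4 * ‖x‖ := by
      have h3 := (unitBasis.proj N).le_of_opNorm_le (norm_unitBasis_proj_le N) x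
      linarith [norm_sub_le x (unitBasis.proj N x)]
    have h3 : (f - f.comp (unitBasis.proj N)) x = f (x - unitBasis.proj N x) := by simp
    rw [h3, Real.norm_eq_abs]
    nlinarith

end James

end MonotoneOp

end

/-! ### Assembly of the three statements -/

open MonotoneOp
theorem mainTheorem5 :
    -- the general statement for a shrinking Schauder basis
    (∀ (X : Type*) [NormedAddCommGroup X] [NormedSpace ℝ X] [CompleteSpace X]
        (b : SchauderBasis ℝ X) (e : StrongDual ℝ (StrongDual ℝ X)),
        IsShrinking b →
        WeakStarTendsto (fun n => incl (∑ i ∈ Finset.range n, b i)) atTop e →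
        MaxMonotone (basisOperator b) ∧ IsLinearOperator (basisOperator b) ∧
          IsSkew (basisOperator b) ∧ IsTypeBR (basisOperator b)) ∧
    -- the James space with its unit vector basis
    (∃ (b : SchauderBasis ℝ James) (e : StrongDual ℝ (StrongDual ℝ James)),
        (∀ n, (b n).toSeq = Pi.single n 1) ∧ IsShrinking b ∧
        (∀ n, e (b.coord n) = 1) ∧
        WeakStarTendsto (fun n => incl (∑ i ∈ Finset.range n, b i)) atTop e ∧
        MaxMonotone (addRankOne (basisOperator b) e) ∧
        ¬ IsTypeD (addRankOne (basisOperator b) e) ∧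
        ¬ IsUnique (addRankOne (basisOperator b) e)) ∧
    -- Banach spaces containing an isomorphic copy of the dual of the James space
    (∀ (Z : Type*) [NormedAddCommGroup Z] [NormedSpace ℝ Z] [CompleteSpace Z]
        (L : StrongDual ℝ James →L[ℝ] Z), IsEmbedding L → ¬ IsTypeDSpace Z) := by
  obtain ⟨e, he⟩ := James.isShrinking_unitBasis.exists_weakStarTendsto_sum
    James.norm_unitBasis_proj_le James.norm_sum_unitBasis_le
  have hb := James.isShrinking_unitBasis
  have hC := James.norm_unitBasis_proj_le
  obtain ⟨f, hfe, hf⟩ := exists_limit_functional he hb hC James.norm_coordinate_le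
  have hmax := maxMonotone_addRankOne he hb hC
  have hrel := fun p hp => related_addRankOne he hb hC (p := p) hfe hf hp
  have hrel₁ := fun p hp => (hrel p hp).2 1 1 (by norm_num)
  have hzero := fun p hp => (hrel p hp).1
  have hne : f ((1 : ℝ) • e) ≠ 0 := by simp [hfe]
  refine ⟨?_, ⟨James.unitBasis, e, James.toSeq_unitVector, hb, coord_of_weakStarTendsto he, he,
    hmax, ?_, ?_⟩, ?_⟩
  · intro X _ _ _ b e hb he
    obtain ⟨C, hC⟩ := b.exists_norm_proj_le
    exact ⟨maxMonotone_basisOperator he hb hC, isLinearOperator_basisOperator he hb hC,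
      isSkew_basisOperator he hb hC, isTypeBR_basisOperator he hb hC⟩
  · exact not_isTypeD_of_related hrel₁ hzero hne
  -- Both `(1, 1)` and `(1/2, 2)` satisfy `ν² ≤ 4μν`, the second with equality, and the mutual
  -- pairing is `(1/2) · (-1) < 0`.
  · refine not_isUnique_of_related (p := ((1 : ℝ) • f, (1 : ℝ) • e))
      (q := ((1 / 2 : ℝ) • f, (2 : ℝ) • e)) hmax hrel₁
      (fun p hp => (hrel p hp).2 (1 / 2) 2 (by norm_num)) ?_
    simp only [_root_.sub_apply, _root_.smul_apply, map_sub, map_smul, hfe, smul_eq_mul]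
    norm_num
  · intro Z _ _ _ L hL
    exact not_isTypeDSpace_of_isEmbedding hL hmax hrel₁ hzero hne
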